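/- Let $X=\{0,1\}$ and let $X^\ast$ be the set of finite words over $X$. The \emph{Basilica group} $B$ is the group of permutations of $X^\ast$ generated by the length-preserving bijections $a,c$ that fix the empty word and satisfy $$a(0w)=0w,\qquad a(1w)=1c(w),\qquad c(0w)=1w,\qquad c(1w)=0a(w)\qquad (w\in X^\ast).$$ It is self-similar: for all $g\in B$ and $x\in X$ there are a unique letter $g(x)\in X$ and a unique element $g|_x\in B$ with $g(xw)=g(x)\,g|_x(w)$ for all $w\in X^\ast$. For a field $K$, the \emph{Nekrashevych algebra} of $B$ over $K$ is the unital $\ast$-algebra over $K$ (with $K$-linear involution) generated by the set $X\cup B$, the identity of $B$ being the identity of the algebra, subject to the relations \begin{itemize} \item $g^\ast=g^{-1}$ and $g\cdot h=gh$ for $g,h\in B$; \item $g\,x=g(x)\,g|_x$ for $g\in B$, $x\in X$; \item $y^\ast x=\delta_{x,y}$ for $x,y\in X$; \item $\sum_{x\in X}xx^\ast=1$. \end{itemize} \textbf{Theorem.} For every field $K$, the Nekrashevych algebra of the Basilica group over $K$ is a simple ring (it is non-zero and has no two-sided ideals other than $0$ and itself). -/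

import Mathlib

universe u v

/-! ## Self-similar groups -/

/-- A group of permutations of the set `X^*` of finite words (that is, a group with a faithful
action on `X^*`) is self-similar if it preserves lengths and for each `g` in it and each letter `x`
there are a letter `g(x)` and an element `g|_x` of the group such that `g(xw) = g(x) g|_x(w)` for
all words `w`. -/
structure IsSelfSimilar {X : Type u} (G : Subgroup (Equiv.Perm (List X))) : Prop where
  length_eq : ∀ g ∈ G, ∀ w : List X, (g w).length = w.length
  exists_section : ∀ g ∈ G, ∀ x : X, ∃ y : X, ∃ h ∈ G, ∀ w : List X, g (x :: w) = y :: h w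

namespace IsSelfSimilar

variable {X : Type u} {G : Subgroup (Equiv.Perm (List X))}

/-- The letter `g(x)`. -/
noncomputable def letter (hG : IsSelfSimilar G) (g : G) (x : X) : X :=
  (hG.exists_section g.1 g.2 x).choose

/-- The section `g|_x`, an element of `G`. -/
noncomputable def sec (hG : IsSelfSimilar G) (g : G) (x : X) : G :=
  ⟨(hG.exists_section g.1 g.2 x).choose_spec.choose,
    (hG.exists_section g.1 g.2 x).choose_spec.choose_spec.1⟩

theorem apply_cons (hG : IsSelfSimilar G) (g : G) (x : X) (w : List X) :
    g.1 (x :: w) = hG.letter g x :: (hG.sec g x).1 w :=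
  (hG.exists_section g.1 g.2 x).choose_spec.choose_spec.2 w

/-- The letter `g(x)` and the section `g|_x` are determined by the defining equation. -/
theorem eq_of_apply_cons (hG : IsSelfSimilar G) {g h : G} {x y : X}
    (H : ∀ w : List X, g.1 (x :: w) = y :: h.1 w) : hG.letter g x = y ∧ hG.sec g x = h := by
  have key : ∀ w, hG.letter g x = y ∧ (hG.sec g x).1 w = h.1 w := fun w => by
    have := (hG.apply_cons g x w).symm.trans (H w)
    exact List.cons_eq_cons.mp this
  exact ⟨(key []).1, Subtype.ext (Equiv.ext fun w => (key w).2)⟩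

end IsSelfSimilar

/-! ## Nekrashevych algebras -/

/-- The free unital `∗`-algebra over `K` on a set `S`: the free algebra on two copies of `S`, where
`Sum.inl s` is the generator `s` and `Sum.inr s` is the formal adjoint `s^∗`. -/
abbrev FreeStarAlg (K : Type v) [CommRing K] (S : Type u) : Type (max u v) :=
  FreeAlgebra K (S ⊕ S)

/-- The involution of the free `∗`-algebra: the `K`-linear anti-automorphism exchanging `s` and
`s^∗` for every `s` in `S`. -/
def FreeStarAlg.adj {K : Type v} [CommRing K] {S : Type u} (p : FreeStarAlg K S) :
    FreeStarAlg K S :=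
  MulOpposite.unop
    (FreeAlgebra.lift K (fun s : S ⊕ S => MulOpposite.op (FreeAlgebra.ι K s.swap)) p)

section Nekrashevych

variable (K : Type v) [CommRing K] {X : Type u} {G : Subgroup (Equiv.Perm (List X))}

/-- The generator `x` for a letter `x`. -/
def nekX (G : Subgroup (Equiv.Perm (List X))) (x : X) : FreeStarAlg K (X ⊕ G) :=
  FreeAlgebra.ι K (Sum.inl (Sum.inl x))

/-- The adjoint `x^∗` of the generator `x`. -/
def nekXAdj (G : Subgroup (Equiv.Perm (List X))) (x : X) : FreeStarAlg K (X ⊕ G) :=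
  FreeAlgebra.ι K (Sum.inr (Sum.inl x))

/-- The generator `g` for an element `g` of the group. -/
def nekG (g : G) : FreeStarAlg K (X ⊕ G) :=
  FreeAlgebra.ι K (Sum.inl (Sum.inr g))

/-- The adjoint `g^∗` of the generator `g`. -/
def nekGAdj (g : G) : FreeStarAlg K (X ⊕ G) :=
  FreeAlgebra.ι K (Sum.inr (Sum.inr g))

/-- The defining relations of the Nekrashevych algebra; the identity of the group is the
identity of the algebra. -/
inductive NekRel [Fintype X] [DecidableEq X] (hG : IsSelfSimilar G) :
    FreeStarAlg K (X ⊕ G) → FreeStarAlg K (X ⊕ G) → Prop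
  | g_adj (g : G) : NekRel hG (nekGAdj K g) (nekG K g⁻¹)
  | g_mul (g h : G) : NekRel hG (nekG K g * nekG K h) (nekG K (g * h))
  | g_one : NekRel hG (nekG K (1 : G)) 1
  | ss (g : G) (x : X) :
      NekRel hG (nekG K g * nekX K G x) (nekX K G (hG.letter g x) * nekG K (hG.sec g x))
  | ck1 (x y : X) : NekRel hG (nekXAdj K G y * nekX K G x) (if x = y then 1 else 0)
  | ck2 : NekRel hG (∑ x : X, nekX K G x * nekXAdj K G x) 1

/-- The relations together with their adjoints. -/
def NekStarRel [Fintype X] [DecidableEq X] (hG : IsSelfSimilar G)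
    (p q : FreeStarAlg K (X ⊕ G)) : Prop :=
  NekRel K hG p q ∨ ∃ p' q', NekRel K hG p' q' ∧ p = p'.adj ∧ q = q'.adj

/-- The Nekrashevych algebra of a self-similar group `G` over the finite alphabet `X` with
coefficients in `K`: the unital `∗`-algebra generated by `X ∪ G` subject to the relations
`NekRel`, that is, the quotient of the free `∗`-algebra by the two-sided ideal generated by
the relations and their adjoints. -/
abbrev NekrashevychAlgebra [Fintype X] [DecidableEq X] (hG : IsSelfSimilar G) :
    Type (max u v) :=
  RingQuot (NekStarRel K hG)

end Nekrashevych

/-! ## The Basilica group -/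

namespace Basilica

mutual
/-- `a(0w) = 0w`, `a(1w) = 1c(w)`. -/
def aFun : List (Fin 2) → List (Fin 2)
  | [] => []
  | 0 :: w => 0 :: w
  | 1 :: w => 1 :: cFun w
/-- `c(0w) = 1w`, `c(1w) = 0a(w)`. -/
def cFun : List (Fin 2) → List (Fin 2)
  | [] => []
  | 0 :: w => 1 :: w
  | 1 :: w => 0 :: aFun w
end

mutual
/-- The inverse of `aFun`. -/
def aInv : List (Fin 2) → List (Fin 2)
  | [] => []
  | 0 :: w => 0 :: w
  | 1 :: w => 1 :: cInv w
/-- The inverse of `cFun`. -/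
def cInv : List (Fin 2) → List (Fin 2)
  | [] => []
  | 1 :: w => 0 :: w
  | 0 :: w => 1 :: aInv w
end

theorem left_inv (w : List (Fin 2)) : aInv (aFun w) = w ∧ cInv (cFun w) = w := by
  induction w with
  | nil => simp [aFun, aInv, cFun, cInv]
  | cons x w ih => fin_cases x <;> simp [aFun, aInv, cFun, cInv, ih.1, ih.2]

theorem right_inv (w : List (Fin 2)) : aFun (aInv w) = w ∧ cFun (cInv w) = w := by
  induction w with
  | nil => simp [aFun, aInv, cFun, cInv]
  | cons x w ih => fin_cases x <;> simp [aFun, aInv, cFun, cInv, ih.1, ih.2]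

theorem length_fun (w : List (Fin 2)) :
    (aFun w).length = w.length ∧ (cFun w).length = w.length := by
  induction w with
  | nil => simp [aFun, cFun]
  | cons x w ih => fin_cases x <;> simp [aFun, cFun, ih.1, ih.2]

/-- The automorphism `a` of the binary tree. -/
def a : Equiv.Perm (List (Fin 2)) where
  toFun := aFun
  invFun := aInv
  left_inv w := (left_inv w).1
  right_inv w := (right_inv w).1

/-- The automorphism `c` of the binary tree. -/
def c : Equiv.Perm (List (Fin 2)) where
  toFun := cFun
  invFun := cInv
  left_inv w := (left_inv w).2
  right_inv w := (right_inv w).2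

/-- The Basilica group, generated by `a` and `c`. -/
def group : Subgroup (Equiv.Perm (List (Fin 2))) := Subgroup.closure {a, c}

theorem isSelfSimilar : IsSelfSimilar group where
  length_eq g hg := by
    induction hg using Subgroup.closure_induction with
    | mem g hg =>
      rcases hg with rfl | rfl
      · exact fun w => (length_fun w).1
      · exact fun w => (length_fun w).2
    | one => exact fun w => rfl
    | mul g h _ _ ihg ihh => exact fun w => (ihg (h w)).trans (ihh w)
    | inv g _ ih =>
      intro w
      have := ih (g⁻¹ w)
      rw [show g (g⁻¹ w) = w from g.apply_symm_apply w] at this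
      exact this.symm
  exists_section g hg := by
    have ha : a ∈ group := Subgroup.subset_closure (by simp)
    have hc : c ∈ group := Subgroup.subset_closure (by simp)
    induction hg using Subgroup.closure_induction'' with
    | mem g hg =>
      rcases hg with rfl | rfl
      · intro x
        fin_cases x
        · exact ⟨0, 1, one_mem _, fun w => by simp [a, aFun]⟩
        · exact ⟨1, c, hc, fun w => by simp [a, c, aFun]⟩
      · intro x
        fin_cases x
        · exact ⟨1, 1, one_mem _, fun w => by simp [c, cFun]⟩
        · exact ⟨0, a, ha, fun w => by simp [a, c, cFun]⟩
    | inv_mem g hg =>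
      rcases hg with rfl | rfl
      · intro x
        fin_cases x
        · exact ⟨0, 1, one_mem _, fun w => by
            rw [Equiv.Perm.inv_eq_iff_eq]; simp [a, aFun]⟩
        · exact ⟨1, c⁻¹, inv_mem hc, fun w => by
            rw [Equiv.Perm.inv_eq_iff_eq]
            change _ = aFun (1 :: c⁻¹ w)
            rw [aFun]
            change _ = 1 :: c (c⁻¹ w)
            rw [show c (c⁻¹ w) = w from c.apply_symm_apply w]; rfl⟩
      · intro x
        fin_cases x
        · exact ⟨1, a⁻¹, inv_mem ha, fun w => by
            rw [Equiv.Perm.inv_eq_iff_eq]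
            change _ = cFun (1 :: a⁻¹ w)
            rw [cFun]
            change _ = 0 :: a (a⁻¹ w)
            rw [show a (a⁻¹ w) = w from a.apply_symm_apply w]; rfl⟩
        · exact ⟨0, 1, one_mem _, fun w => by
            rw [Equiv.Perm.inv_eq_iff_eq]; simp [c, cFun]⟩
    | one => exact fun x => ⟨x, 1, one_mem _, fun w => rfl⟩
    | mul g h _ _ ihg ihh =>
      intro x
      obtain ⟨y, h', hh', H⟩ := ihh x
      obtain ⟨z, g', hg', K⟩ := ihg y
      exact ⟨z, g' * h', mul_mem hg' hh', fun w => by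
        rw [Equiv.Perm.mul_apply, H, K, Equiv.Perm.mul_apply]⟩

end Basilica

-- The Basilica group is contracting: deep sections of any element lie in the finite set `nucleus`.
-- A nucleus element that fixes a word of length two has trivial section there, so an element fixing
-- a sufficiently long word acts trivially below it (`FixesStrongly`). In groupoid terms, an element
-- that fixes an infinite word is trivial near it, and two elements that agree on a long word `u`
-- have equal sections at `u`.
--
-- Simplicity follows from this property for any self-similar group over a finite alphabet with at
-- least two letters. Take `p ≠ 0` in an ideal. Multiplying on the right by a long word removes all
-- adjoint letters and leaves a combination of products `w g`. Let `d` be the lowest length of `w`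
-- that occurs; multiplying on the left by the adjoint of a word of length `d` turns the lowest part
-- into a nonzero combination of group elements and leaves a remainder with words of length at least
-- one. Compressing by long words of equal length merges the group elements into one, `k • h` with
-- `k ≠ 0`, and `h⁻¹` turns this into `k`. Finally some word `t` satisfies `t^* r t = 0` for the
-- remainder `r`, whereas `t^* k t = k`; so the unit `k` lies in the ideal.
--
-- The algebra is nonzero because it acts on the `K`-valued functions on infinite words.

-- Sections at words and triviality of germs

namespace IsSelfSimilar

variable {X : Type u} {G : Subgroup (Equiv.Perm (List X))} (hG : IsSelfSimilar G)

theorem letter_mul (g h : G) (x : X) :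
    hG.letter (g * h) x = hG.letter g (hG.letter h x) :=
  (hG.eq_of_apply_cons (g := g * h) (y := hG.letter g (hG.letter h x))
    (h := hG.sec g (hG.letter h x) * hG.sec h x) fun w => by
    simp [hG.apply_cons]).1

theorem sec_mul (g h : G) (x : X) :
    hG.sec (g * h) x = hG.sec g (hG.letter h x) * hG.sec h x :=
  (hG.eq_of_apply_cons (g := g * h) (y := hG.letter g (hG.letter h x))
    (h := hG.sec g (hG.letter h x) * hG.sec h x) fun w => by
    simp [hG.apply_cons]).2

theorem letter_one (x : X) : hG.letter 1 x = x :=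
  (hG.eq_of_apply_cons (g := 1) (h := 1) fun w => by simp).1

theorem sec_one (x : X) : hG.sec 1 x = 1 :=
  (hG.eq_of_apply_cons (g := 1) (h := 1) (x := x) (y := x) fun w => by simp).2

/-- The section `g|_u` at a word `u`. -/
noncomputable def secWord (g : G) : List X → G
  | [] => g
  | x :: u => secWord (hG.sec g x) u

theorem apply_nil {G : Subgroup (Equiv.Perm (List X))} (hG : IsSelfSimilar G) (g : G) :
    g.1 [] = [] :=
  List.length_eq_zero_iff.mp (hG.length_eq g.1 g.2 [])

theorem apply_append (g : G) (u w : List X) :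
    g.1 (u ++ w) = g.1 u ++ (hG.secWord g u).1 w := by
  induction u generalizing g with
  | nil => simp [secWord, hG.apply_nil]
  | cons x u ih => simp [secWord, hG.apply_cons, ih]

theorem secWord_append (g : G) (u w : List X) :
    hG.secWord g (u ++ w) = hG.secWord (hG.secWord g u) w := by
  induction u generalizing g with
  | nil => rfl
  | cons x u ih => exact ih _

theorem secWord_one (u : List X) : hG.secWord 1 u = 1 := by
  induction u with
  | nil => rfl
  | cons x u ih => simp [secWord, sec_one, ih]

theorem secWord_mul (g h : G) (u : List X) :
    hG.secWord (g * h) u = hG.secWord g (h.1 u) * hG.secWord h u := by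
  induction u generalizing g h with
  | nil => simp [secWord, hG.apply_nil]
  | cons x u ih => simp [secWord, sec_mul, ih, hG.apply_cons]

/-- If an element fixes a sufficiently long word, then its section there is trivial; hence all germs
of the action on infinite words are principal. -/
def FixesStrongly : Prop :=
  ∀ g : G, ∃ n : ℕ, ∀ u : List X, n ≤ u.length → g.1 u = u → hG.secWord g u = 1

variable {hG}

/-- The element `h⁻¹ * g` fixes every word on which `g` and `h` agree. -/
theorem FixesStrongly.secWord_eq (H : hG.FixesStrongly) (g h : G) :
    ∃ n : ℕ, ∀ u : List X, n ≤ u.length → g.1 u = h.1 u → hG.secWord g u = hG.secWord h u := by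
  obtain ⟨n, hn⟩ := H (h⁻¹ * g)
  refine ⟨n, fun u hu e => ?_⟩
  have hfix : (h⁻¹ * g).1 u = u := by
    simp [e]
  have h1 := hn u hu hfix
  calc hG.secWord g u = hG.secWord (h * (h⁻¹ * g)) u := by simp
    _ = hG.secWord h u := by rw [secWord_mul, h1, hfix, mul_one]

theorem FixesStrongly.secWord_eq_finset (H : hG.FixesStrongly) (s : Finset G) :
    ∃ n : ℕ, ∀ u : List X, n ≤ u.length → ∀ g ∈ s, ∀ h ∈ s, g.1 u = h.1 u →
      hG.secWord g u = hG.secWord h u := by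
  choose N hN using H.secWord_eq
  refine ⟨s.sup fun g => s.sup fun h => N g h, fun u hu g hg h hh e => hN g h u ?_ e⟩
  exact le_trans (le_trans (Finset.le_sup (f := fun h => N g h) hh)
    (Finset.le_sup (f := fun g => s.sup fun h => N g h) hg)) hu

-- The action on infinite words

variable (hG)

/-- The action of `G` on infinite words. -/
noncomputable def act (g : G) (ω : ℕ → X) : ℕ → X
  | 0 => hG.letter g (ω 0)
  | n + 1 => act (hG.sec g (ω 0)) (fun k => ω (k + 1)) n

theorem act_one (ω : ℕ → X) : hG.act 1 ω = ω := by
  funext n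
  induction n generalizing ω with
  | zero => simp [act, letter_one]
  | succ n ih => simp [act, sec_one, ih]

theorem act_mul (g h : G) (ω : ℕ → X) : hG.act (g * h) ω = hG.act g (hG.act h ω) := by
  funext n
  induction n generalizing g h ω with
  | zero => simp [act, letter_mul]
  | succ n ih => simp [act, sec_mul, ih]

/-- Prepending a letter to an infinite word. -/
def prepend (x : X) (ω : ℕ → X) : ℕ → X
  | 0 => x
  | n + 1 => ω n

theorem act_prepend (g : G) (x : X) (ω : ℕ → X) :
    hG.act g (prepend x ω) = prepend (hG.letter g x) (hG.act (hG.sec g x) ω) := by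
  funext n
  cases n <;> rfl

theorem prepend_tail (ω : ℕ → X) : prepend (ω 0) (fun n => ω (n + 1)) = ω := by
  funext n
  cases n <;> rfl

end IsSelfSimilar

-- Words and group elements in the Nekrashevych algebra

namespace NekrashevychAlgebra

open IsSelfSimilar

section Relations

variable (K : Type v) [CommRing K] {X : Type u} [Fintype X] [DecidableEq X]
  {G : Subgroup (Equiv.Perm (List X))} (hG : IsSelfSimilar G)

/-- The image of a letter in the Nekrashevych algebra. -/
def ofX (x : X) : NekrashevychAlgebra K hG := RingQuot.mkAlgHom K _ (nekX K G x)

/-- The image of the adjoint of a letter in the Nekrashevych algebra. -/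
def ofXAdj (x : X) : NekrashevychAlgebra K hG := RingQuot.mkAlgHom K _ (nekXAdj K G x)

/-- The image of a group element in the Nekrashevych algebra. -/
def ofG (g : G) : NekrashevychAlgebra K hG := RingQuot.mkAlgHom K _ (nekG K g)

variable {K} in
theorem mk_eq_of_rel {p q : FreeStarAlg K (X ⊕ G)} (h : NekRel K hG p q) :
    RingQuot.mkAlgHom K (NekStarRel K hG) p = RingQuot.mkAlgHom K (NekStarRel K hG) q :=
  RingQuot.mkAlgHom_rel K (Or.inl h)

theorem ofG_mul (g h : G) : ofG K hG (g * h) = ofG K hG g * ofG K hG h := by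
  simpa [ofG] using (mk_eq_of_rel hG (NekRel.g_mul (K := K) (hG := hG) g h)).symm

theorem ofG_one : ofG K hG 1 = 1 := by
  simpa [ofG] using mk_eq_of_rel hG (NekRel.g_one (K := K) (hG := hG))

theorem ofG_mul_ofX (g : G) (x : X) :
    ofG K hG g * ofX K hG x = ofX K hG (hG.letter g x) * ofG K hG (hG.sec g x) := by
  simpa [ofG, ofX] using mk_eq_of_rel hG (NekRel.ss (K := K) (hG := hG) g x)

theorem ofXAdj_mul_ofX (y x : X) :
    ofXAdj K hG y * ofX K hG x = if x = y then 1 else 0 := by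
  have := mk_eq_of_rel hG (NekRel.ck1 (K := K) (hG := hG) x y)
  rw [map_mul] at this
  rw [ofXAdj, ofX, this]
  split_ifs <;> simp

theorem sum_ofX_mul_ofXAdj : ∑ x : X, ofX K hG x * ofXAdj K hG x = 1 := by
  simpa [ofX, ofXAdj] using mk_eq_of_rel hG (NekRel.ck2 (K := K) (hG := hG))

/-- The adjoints of group elements need no hypothesis, since they are the inverses. -/
theorem mem_of_generators (S : Subalgebra K (NekrashevychAlgebra K hG))
    (hX : ∀ x, ofX K hG x ∈ S) (hXAdj : ∀ x, ofXAdj K hG x ∈ S) (hg : ∀ g, ofG K hG g ∈ S)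
    (p : NekrashevychAlgebra K hG) : p ∈ S := by
  obtain ⟨p, rfl⟩ := RingQuot.mkAlgHom_surjective K _ p
  induction p using FreeAlgebra.induction with
  | grade0 r => rw [AlgHom.commutes]; exact S.algebraMap_mem r
  | grade1 s =>
    rcases s with (x | g) | (x | g)
    · exact hX x
    · exact hg g
    · exact hXAdj x
    · have := mk_eq_of_rel hG (NekRel.g_adj (K := K) (hG := hG) g)
      change RingQuot.mkAlgHom K _ (nekGAdj K g) ∈ S
      rw [this]
      exact hg g⁻¹
  | mul p q hp hq => rw [map_mul]; exact S.mul_mem hp hq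
  | add p q hp hq => rw [map_add]; exact S.add_mem hp hq

/-- The image of a word in the Nekrashevych algebra. -/
def ofWord : List X → NekrashevychAlgebra K hG
  | [] => 1
  | x :: u => ofX K hG x * ofWord u

/-- The image of the adjoint of a word in the Nekrashevych algebra. -/
def ofWordAdj : List X → NekrashevychAlgebra K hG
  | [] => 1
  | x :: u => ofWordAdj u * ofXAdj K hG x

theorem ofWord_append (u w : List X) :
    ofWord K hG (u ++ w) = ofWord K hG u * ofWord K hG w := by
  induction u with
  | nil => simp [ofWord]
  | cons x u ih => simp [ofWord, ih, mul_assoc]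

theorem ofWordAdj_append (u w : List X) :
    ofWordAdj K hG (u ++ w) = ofWordAdj K hG w * ofWordAdj K hG u := by
  induction u with
  | nil => simp [ofWordAdj]
  | cons x u ih => simp [ofWordAdj, ih, mul_assoc]

theorem ofG_mul_ofWord (g : G) (u : List X) :
    ofG K hG g * ofWord K hG u = ofWord K hG (g.1 u) * ofG K hG (hG.secWord g u) := by
  induction u generalizing g with
  | nil => simp [ofWord, secWord, hG.apply_nil]
  | cons x u ih =>
    rw [ofWord, ← mul_assoc, ofG_mul_ofX, mul_assoc, ih, hG.apply_cons, ofWord, secWord, mul_assoc]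

theorem ofWordAdj_mul_ofWord_self (u : List X) : ofWordAdj K hG u * ofWord K hG u = 1 := by
  induction u with
  | nil => simp [ofWord, ofWordAdj]
  | cons x u ih =>
    rw [ofWord, ofWordAdj, mul_assoc, ← mul_assoc (ofXAdj K hG x), ofXAdj_mul_ofX, if_pos rfl,
      one_mul, ih]

theorem ofWordAdj_mul_ofWord_eq_zero_or (u w : List X) (h : u.length ≤ w.length) :
    ofWordAdj K hG u * ofWord K hG w = 0 ∨ ∃ z, w = u ++ z := by
  induction u generalizing w with
  | nil => exact Or.inr ⟨w, rfl⟩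
  | cons x u ih =>
    cases w with
    | nil => simp at h
    | cons y w =>
      rw [ofWord, ofWordAdj, mul_assoc, ← mul_assoc (ofXAdj K hG x), ofXAdj_mul_ofX]
      by_cases hyx : y = x
      · subst hyx
        rcases ih w (by simpa using h) with h0 | ⟨z, rfl⟩
        · left; simpa using h0
        · right; exact ⟨z, rfl⟩
      · left; simp [hyx]

theorem ofWordAdj_mul_ofWord_append (u z : List X) :
    ofWordAdj K hG u * ofWord K hG (u ++ z) = ofWord K hG z := by
  rw [ofWord_append, ← mul_assoc, ofWordAdj_mul_ofWord_self, one_mul]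

/-- Since the `x x^*` sum to one, an element annihilated by every letter on the right is zero. -/
theorem exists_mul_ofWord_ne_zero (n : ℕ) {p : NekrashevychAlgebra K hG} (hp : p ≠ 0) :
    ∃ u : List X, u.length = n ∧ p * ofWord K hG u ≠ 0 := by
  induction n generalizing p with
  | zero => exact ⟨[], rfl, by simpa [ofWord] using hp⟩
  | succ n ih =>
    obtain ⟨x, hx⟩ : ∃ x, p * ofX K hG x ≠ 0 := by
      by_contra! h
      apply hp
      rw [← mul_one p, ← sum_ofX_mul_ofXAdj, Finset.mul_sum]
      exact Finset.sum_eq_zero fun x _ => by rw [← mul_assoc, h, zero_mul]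
    obtain ⟨u, hu, h⟩ := ih hx
    exact ⟨x :: u, by simp [hu], by rwa [ofWord, ← mul_assoc]⟩

theorem exists_ofWordAdj_mul_ne_zero (n : ℕ) {p : NekrashevychAlgebra K hG} (hp : p ≠ 0) :
    ∃ u : List X, u.length = n ∧ ofWordAdj K hG u * p ≠ 0 := by
  induction n generalizing p with
  | zero => exact ⟨[], rfl, by simpa [ofWordAdj] using hp⟩
  | succ n ih =>
    obtain ⟨x, hx⟩ : ∃ x, ofXAdj K hG x * p ≠ 0 := by
      by_contra! h
      apply hp
      rw [← one_mul p, ← sum_ofX_mul_ofXAdj, Finset.sum_mul]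
      exact Finset.sum_eq_zero fun x _ => by rw [mul_assoc, h, mul_zero]
    obtain ⟨u, hu, h⟩ := ih hx
    exact ⟨x :: u, by simp [hu], by rwa [ofWordAdj, mul_assoc]⟩

-- Filtration by word length

/-- The span of the elements `w g` with `w` a word of length `d` and `g` in `G`. -/
def degreeSpan (d : ℕ) : Submodule K (NekrashevychAlgebra K hG) :=
  Submodule.span K {p | ∃ (w : List X) (g : G), w.length = d ∧ p = ofWord K hG w * ofG K hG g}

/-- The span of the elements `w g` with `w` a word of length at least `m` and `g` in `G`. -/
def tailSpan (m : ℕ) : Submodule K (NekrashevychAlgebra K hG) :=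
  Submodule.span K {p | ∃ (w : List X) (g : G), m ≤ w.length ∧ p = ofWord K hG w * ofG K hG g}

variable {K hG}

theorem ofWord_mul_ofG_mem_tailSpan {m : ℕ} {w : List X} (hw : m ≤ w.length) (g : G) :
    ofWord K hG w * ofG K hG g ∈ tailSpan K hG m :=
  Submodule.subset_span ⟨w, g, hw, rfl⟩

theorem ofWord_mem_tailSpan {m : ℕ} {w : List X} (hw : m ≤ w.length) :
    ofWord K hG w ∈ tailSpan K hG m := by
  simpa [ofG_one] using ofWord_mul_ofG_mem_tailSpan (K := K) (hG := hG) hw 1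

theorem degreeSpan_le_tailSpan {d m : ℕ} (h : m ≤ d) : degreeSpan K hG d ≤ tailSpan K hG m :=
  Submodule.span_mono fun _ ⟨w, g, hw, e⟩ => ⟨w, g, hw ▸ h, e⟩

theorem tailSpan_le_iSup_degreeSpan (m : ℕ) : tailSpan K hG m ≤ ⨆ d, degreeSpan K hG d :=
  Submodule.span_le.mpr fun _ ⟨w, g, _, e⟩ =>
    Submodule.mem_iSup_of_mem w.length (Submodule.subset_span ⟨w, g, rfl, e⟩)

/-- A linear operation maps a `tailSpan` into a submodule if it does so on the spanning set. -/
theorem mul_mul_mem_of_mem_tailSpan {m : ℕ} {S : Submodule K (NekrashevychAlgebra K hG)}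
    {a b : NekrashevychAlgebra K hG}
    (h : ∀ (w : List X) (g : G), m ≤ w.length → a * (ofWord K hG w * ofG K hG g) * b ∈ S)
    {p : NekrashevychAlgebra K hG} (hp : p ∈ tailSpan K hG m) : a * p * b ∈ S := by
  induction hp using Submodule.span_induction with
  | mem p hp => obtain ⟨w, g, hw, rfl⟩ := hp; exact h w g hw
  | zero => simp
  | add p q _ _ hp hq => rw [mul_add, add_mul]; exact S.add_mem hp hq
  | smul k p _ hp => rw [mul_smul_comm, smul_mul_assoc]; exact S.smul_mem k hp

theorem mul_ofG_mem_tailSpan {m : ℕ} {p : NekrashevychAlgebra K hG} (hp : p ∈ tailSpan K hG m)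
    (h : G) : p * ofG K hG h ∈ tailSpan K hG m := by
  rw [← one_mul p]
  refine mul_mul_mem_of_mem_tailSpan (fun w g hw => ?_) hp
  rw [one_mul, mul_assoc, ← ofG_mul]
  exact ofWord_mul_ofG_mem_tailSpan hw _

theorem ofG_mul_mem_tailSpan {m : ℕ} {p : NekrashevychAlgebra K hG} (hp : p ∈ tailSpan K hG m)
    (h : G) : ofG K hG h * p ∈ tailSpan K hG m := by
  rw [← mul_one (_ * p)]
  refine mul_mul_mem_of_mem_tailSpan (fun w g hw => ?_) hp
  rw [mul_one, ← mul_assoc, ofG_mul_ofWord, mul_assoc, ← ofG_mul]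
  exact ofWord_mul_ofG_mem_tailSpan (by rwa [hG.length_eq h.1 h.2]) _

/-- Moving `g` past `u` preserves the length of `u`, and `y^*` either gives zero or cancels a prefix
of length `y.length`. -/
theorem ofWordAdj_mul_mul_ofWord_mem_tailSpan {m d : ℕ} {y u : List X}
    (hy : y.length + m ≤ d + u.length) {p : NekrashevychAlgebra K hG}
    (hp : p ∈ tailSpan K hG d) :
    ofWordAdj K hG y * p * ofWord K hG u ∈ tailSpan K hG m := by
  refine mul_mul_mem_of_mem_tailSpan (fun w g hw => ?_) hp
  have hu := hG.length_eq g.1 g.2 u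
  rw [mul_assoc, mul_assoc, ofG_mul_ofWord, ← mul_assoc (ofWord K hG w), ← ofWord_append,
    ← mul_assoc]
  rcases ofWordAdj_mul_ofWord_eq_zero_or K hG y (w ++ g.1 u)
    (by rw [List.length_append, hu]; omega) with h | ⟨z, hz⟩
  · simp [h]
  · have hl := congrArg List.length hz
    rw [List.length_append, List.length_append, hu] at hl
    rw [hz, ofWordAdj_mul_ofWord_append]
    exact ofWord_mul_ofG_mem_tailSpan (by omega) _

variable (K hG) in
/-- The elements that map sufficiently long words into any prescribed `tailSpan`. -/
def expansive : Subalgebra K (NekrashevychAlgebra K hG) where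
  carrier := {p | ∀ m : ℕ, ∃ n : ℕ, ∀ u : List X, n ≤ u.length →
    p * ofWord K hG u ∈ tailSpan K hG m}
  -- Closure under products is why every `m` is prescribed: `q` must produce words long enough for
  -- `p`. Simplicity itself uses only `m = 0`.
  mul_mem' {p q} hp hq m := by
    obtain ⟨l, hl⟩ := hp m
    obtain ⟨n, hn⟩ := hq l
    refine ⟨n, fun u hu => ?_⟩
    rw [mul_assoc, ← mul_one (p * _)]
    refine mul_mul_mem_of_mem_tailSpan (fun w g hw => ?_) (hn u hu)
    rw [mul_one, ← mul_assoc]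
    exact mul_ofG_mem_tailSpan (hl w hw) g
  add_mem' {p q} hp hq m := by
    obtain ⟨l, hl⟩ := hp m
    obtain ⟨n, hn⟩ := hq m
    refine ⟨max l n, fun u hu => ?_⟩
    rw [add_mul]
    exact add_mem (hl u (le_of_max_le_left hu)) (hn u (le_of_max_le_right hu))
  algebraMap_mem' k m := ⟨m, fun u hu => by
    rw [← Algebra.smul_def]
    exact Submodule.smul_mem _ k (ofWord_mem_tailSpan hu)⟩

theorem mem_expansive (p : NekrashevychAlgebra K hG) : p ∈ expansive K hG := by
  refine mem_of_generators K hG (expansive K hG) (fun x m => ⟨m, fun u hu => ?_⟩)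
    -- An adjoint letter cancels one letter, hence `m + 1`.
    (fun x m => ⟨m + 1, fun u hu => ?_⟩) (fun g m => ⟨m, fun u hu => ?_⟩) p
  · exact ofWord_mem_tailSpan (w := x :: u) (by simp; omega)
  · cases u with
    | nil => simp at hu
    | cons y u =>
      rw [ofWord, ← mul_assoc, ofXAdj_mul_ofX]
      split_ifs
      · rw [one_mul]; exact ofWord_mem_tailSpan (by simpa using hu)
      · simp
  · rw [ofG_mul_ofWord]
    exact ofWord_mul_ofG_mem_tailSpan (by rwa [hG.length_eq g.1 g.2]) _

/-- Independence of the degree spans is not needed: any decomposition of `p` into terms of distinct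
degrees has a nonzero term of least degree. -/
theorem exists_degreeSpan_add_tailSpan {p : NekrashevychAlgebra K hG}
    (hp : p ∈ tailSpan K hG 0) (h0 : p ≠ 0) :
    ∃ d, ∃ q ∈ degreeSpan K hG d, ∃ r ∈ tailSpan K hG (d + 1), q ≠ 0 ∧ p = q + r := by
  obtain ⟨f, hf, rfl⟩ := (Submodule.mem_iSup_iff_exists_finsupp _ _).mp
    (tailSpan_le_iSup_degreeSpan 0 hp)
  have hne : f.support.Nonempty := by
    rw [Finsupp.support_nonempty_iff]
    rintro rfl
    simp at h0
  refine ⟨f.support.min' hne, _, hf _, ∑ i ∈ f.support.erase (f.support.min' hne), f i, ?_,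
    Finsupp.mem_support_iff.mp (Finset.min'_mem _ hne), ?_⟩
  · refine Submodule.sum_mem _ fun i hi => degreeSpan_le_tailSpan ?_ (hf i)
    exact Finset.min'_lt_of_mem_erase_min' _ hne hi
  · exact (Finset.add_sum_erase _ _ (Finset.min'_mem _ hne)).symm

theorem ofWordAdj_mul_mem_span_ofG {d : ℕ} {y : List X} (hy : y.length = d)
    {p : NekrashevychAlgebra K hG} (hp : p ∈ degreeSpan K hG d) :
    ofWordAdj K hG y * p ∈ Submodule.span K (Set.range (ofG K hG)) := by
  induction hp using Submodule.span_induction with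
  | mem p hp =>
    obtain ⟨w, g, hw, rfl⟩ := hp
    rw [← mul_assoc]
    rcases ofWordAdj_mul_ofWord_eq_zero_or K hG y w (by omega) with h | ⟨z, hz⟩
    · simp [h]
    · have hl := congrArg List.length hz
      rw [List.length_append] at hl
      have : z = [] := List.length_eq_zero_iff.mp (by omega)
      rw [hz, ofWordAdj_mul_ofWord_append, this, ofWord, one_mul]
      exact Submodule.subset_span ⟨g, rfl⟩
  | zero => simp
  | add p q _ _ hp hq => rw [mul_add]; exact add_mem hp hq
  | smul k p _ hp => rw [mul_smul_comm]; exact Submodule.smul_mem _ k hp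

/-- Compression by `y` and `u` keeps exactly the `g` with `g(u) = y`. For `u` long enough these all
have the same section at `u`, so their terms collapse to one. Its coefficient is nonzero because `y`
and `u` are chosen to keep the compression nonzero; linear independence of the group elements plays
no role. -/
theorem exists_ofWordAdj_mul_mul_ofWord_eq_smul_ofG (H : hG.FixesStrongly)
    {p : NekrashevychAlgebra K hG} (hp : p ∈ Submodule.span K (Set.range (ofG K hG)))
    (h0 : p ≠ 0) :
    ∃ (y u : List X) (k : K) (h : G), y.length = u.length ∧ k ≠ 0 ∧
      ofWordAdj K hG y * p * ofWord K hG u = k • ofG K hG h := by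
  obtain ⟨c, rfl⟩ := (Finsupp.mem_span_range_iff_exists_finsupp).mp hp
  obtain ⟨n, hn⟩ := H.secWord_eq_finset c.support
  obtain ⟨u, hu, h1⟩ := exists_mul_ofWord_ne_zero K hG n h0
  obtain ⟨y, hy, h2⟩ := exists_ofWordAdj_mul_ne_zero K hG n h1
  have key : ∀ g : G, ofWordAdj K hG y * (ofG K hG g * ofWord K hG u) =
      if g.1 u = y then ofG K hG (hG.secWord g u) else 0 := by
    intro g
    have hl := hG.length_eq g.1 g.2 u
    rw [ofG_mul_ofWord, ← mul_assoc]
    split_ifs with e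
    · rw [e, ofWordAdj_mul_ofWord_self, one_mul]
    · rcases ofWordAdj_mul_ofWord_eq_zero_or K hG y (g.1 u) (by omega) with h | ⟨z, hz⟩
      · rw [h, zero_mul]
      · have hl' := congrArg List.length hz
        rw [List.length_append] at hl'
        have : z = [] := List.length_eq_zero_iff.mp (by omega)
        exact absurd (by simpa [this] using hz) e
  have expand : ofWordAdj K hG y * (c.sum (fun g k => k • ofG K hG g) * ofWord K hG u) =
      ∑ g ∈ c.support with g.1 u = y, c g • ofG K hG (hG.secWord g u) := by
    rw [Finsupp.sum, Finset.sum_mul, Finset.mul_sum, Finset.sum_filter]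
    refine Finset.sum_congr rfl fun g _ => ?_
    rw [smul_mul_assoc, mul_smul_comm, key]
    split_ifs <;> simp
  rw [expand] at h2
  obtain ⟨h, hh, -⟩ := Finset.exists_ne_zero_of_sum_ne_zero h2
  rw [Finset.mem_filter] at hh
  have collect : ∑ g ∈ c.support with g.1 u = y, c g • ofG K hG (hG.secWord g u) =
      (∑ g ∈ c.support with g.1 u = y, c g) • ofG K hG (hG.secWord h u) := by
    rw [Finset.sum_smul]
    refine Finset.sum_congr rfl fun g hg => ?_
    rw [Finset.mem_filter] at hg
    rw [hn u hu.ge g hg.1 h hh.1 (hg.2.trans hh.2.symm)]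
  refine ⟨y, u, _, hG.secWord h u, hy.trans hu.symm, fun hk => ?_,
    (mul_assoc _ _ _).trans (expand.trans collect)⟩
  rw [collect, hk, zero_smul] at h2
  exact h2 rfl

theorem ofWordAdj_mul_mul_ofWord_append_eq_zero {u : List X} (v : List X)
    {p : NekrashevychAlgebra K hG} (h : ofWordAdj K hG u * p * ofWord K hG u = 0) :
    ofWordAdj K hG (u ++ v) * p * ofWord K hG (u ++ v) = 0 := by
  have : ofWordAdj K hG (u ++ v) * p * ofWord K hG (u ++ v) =
      ofWordAdj K hG v * (ofWordAdj K hG u * p * ofWord K hG u) * ofWord K hG v := by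
    simp only [ofWordAdj_append, ofWord_append, mul_assoc]
  rw [this, h, mul_zero, zero_mul]

/-- A product `w g` with `w` nonempty shifts lengths, so compression by `u` gives either zero or `z`
times a group element with `z` nonempty; one further letter different from the first letter of `z`
then kills it. The arbitrary starting word `u` allows summands to be killed successively. -/
theorem exists_ofWordAdj_mul_mul_ofWord_eq_zero [Nontrivial X] {p : NekrashevychAlgebra K hG}
    (hp : p ∈ tailSpan K hG 1) (u : List X) :
    ∃ v, ofWordAdj K hG (u ++ v) * p * ofWord K hG (u ++ v) = 0 := by
  induction hp using Submodule.span_induction generalizing u with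
  | mem p hp =>
    obtain ⟨w, g, hw, rfl⟩ := hp
    have hu := hG.length_eq g.1 g.2 u
    have e : ofWordAdj K hG u * (ofWord K hG w * ofG K hG g) * ofWord K hG u =
        ofWordAdj K hG u * ofWord K hG (w ++ g.1 u) * ofG K hG (hG.secWord g u) := by
      rw [mul_assoc, mul_assoc, ofG_mul_ofWord, ofWord_append]
      simp only [mul_assoc]
    rcases ofWordAdj_mul_ofWord_eq_zero_or K hG u (w ++ g.1 u)
      (by rw [List.length_append, hu]; omega) with h | ⟨z, hz⟩
    · exact ⟨[], ofWordAdj_mul_mul_ofWord_append_eq_zero [] (by rw [e, h, zero_mul])⟩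
    · have hl := congrArg List.length hz
      rw [List.length_append, List.length_append, hu] at hl
      cases z with
      | nil => rw [List.length_nil] at hl; omega
      | cons x z =>
        obtain ⟨y, hy⟩ := exists_ne x
        refine ⟨[y], ?_⟩
        rw [hz, ofWordAdj_mul_ofWord_append] at e
        have : ofWordAdj K hG (u ++ [y]) * (ofWord K hG w * ofG K hG g) * ofWord K hG (u ++ [y]) =
            ofXAdj K hG y * (ofWordAdj K hG u * (ofWord K hG w * ofG K hG g) * ofWord K hG u) *
              ofX K hG y := by
          simp [ofWordAdj_append, ofWord_append, mul_assoc, ofWord, ofWordAdj]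
        rw [this, e, ofWord]
        simp only [← mul_assoc]
        rw [ofXAdj_mul_ofX, if_neg hy.symm]
        simp
  | zero => exact ⟨[], by simp⟩
  | add p q _ _ hp hq =>
    obtain ⟨v, hv⟩ := hp u
    -- The word that kills `q` extends the one that kills `p`, and vanishing persists under
    -- extension.
    obtain ⟨w, hw⟩ := hq (u ++ v)
    refine ⟨v ++ w, ?_⟩
    rw [← List.append_assoc, mul_add, add_mul, ofWordAdj_mul_mul_ofWord_append_eq_zero w hv, hw,
      add_zero]
  | smul k p _ hp =>
    obtain ⟨v, hv⟩ := hp u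
    exact ⟨v, by rw [mul_smul_comm, smul_mul_assoc, hv, smul_zero]⟩

end Relations

-- The involution on the free algebra

section Adjoint

variable (K : Type v) [CommRing K] {X : Type u} {G : Subgroup (Equiv.Perm (List X))}

theorem adj_ι {S : Type*} (s : S ⊕ S) :
    FreeStarAlg.adj (FreeAlgebra.ι K s) = FreeAlgebra.ι K s.swap := by
  simp [FreeStarAlg.adj]

theorem adj_mul {S : Type*} (p q : FreeStarAlg K S) : (p * q).adj = q.adj * p.adj := by
  simp [FreeStarAlg.adj]

theorem adj_one {S : Type*} : (1 : FreeStarAlg K S).adj = 1 := by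
  simp [FreeStarAlg.adj]

theorem adj_zero {S : Type*} : (0 : FreeStarAlg K S).adj = 0 := by
  simp [FreeStarAlg.adj]

theorem adj_sum {S ι : Type*} (s : Finset ι) (f : ι → FreeStarAlg K S) :
    (∑ i ∈ s, f i).adj = ∑ i ∈ s, (f i).adj := by
  simp [FreeStarAlg.adj]

variable (G) in
theorem adj_nekX (x : X) : (nekX K G x).adj = nekXAdj K G x := adj_ι K _

variable (G) in
theorem adj_nekXAdj (x : X) : (nekXAdj K G x).adj = nekX K G x := adj_ι K _

theorem adj_nekG (g : G) : (nekG K g).adj = nekGAdj K g := adj_ι K _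

theorem adj_nekGAdj (g : G) : (nekGAdj K g).adj = nekG K g := adj_ι K _

end Adjoint

-- Nontriviality through functions on infinite words

section Representation

variable (K : Type v) [CommRing K] {X : Type u} [DecidableEq X]
  {G : Subgroup (Equiv.Perm (List X))} (hG : IsSelfSimilar G)

/-- The action of the generators of the Nekrashevych algebra on functions on infinite words. -/
noncomputable def genRep : (X ⊕ G) ⊕ (X ⊕ G) → Module.End K ((ℕ → X) → K)
  | Sum.inl (Sum.inl x) => LinearMap.pi fun ω =>
      if ω 0 = x then LinearMap.proj (fun n => ω (n + 1)) else 0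
  | Sum.inl (Sum.inr g) => LinearMap.funLeft K K (hG.act g⁻¹)
  | Sum.inr (Sum.inl x) => LinearMap.funLeft K K (prepend x)
  | Sum.inr (Sum.inr g) => LinearMap.funLeft K K (hG.act g)

theorem lift_genRep_nekX (x : X) (f : (ℕ → X) → K) (ω : ℕ → X) :
    FreeAlgebra.lift K (genRep K hG) (nekX K G x) f ω =
      if ω 0 = x then f (fun n => ω (n + 1)) else 0 := by
  rw [nekX, FreeAlgebra.lift_ι_apply]
  simp only [genRep, LinearMap.pi_apply]
  split_ifs <;> rfl

theorem lift_genRep_nekXAdj (x : X) (f : (ℕ → X) → K) (ω : ℕ → X) :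
    FreeAlgebra.lift K (genRep K hG) (nekXAdj K G x) f ω = f (prepend x ω) := by
  rw [nekXAdj, FreeAlgebra.lift_ι_apply]
  rfl

theorem lift_genRep_nekG (g : G) (f : (ℕ → X) → K) (ω : ℕ → X) :
    FreeAlgebra.lift K (genRep K hG) (nekG K g) f ω = f (hG.act g⁻¹ ω) := by
  rw [nekG, FreeAlgebra.lift_ι_apply]
  rfl

theorem lift_genRep_nekGAdj (g : G) (f : (ℕ → X) → K) (ω : ℕ → X) :
    FreeAlgebra.lift K (genRep K hG) (nekGAdj K g) f ω = f (hG.act g ω) := by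
  rw [nekGAdj, FreeAlgebra.lift_ι_apply]
  rfl

theorem lift_genRep_rel [Fintype X] {p q : FreeStarAlg K (X ⊕ G)} (h : NekStarRel K hG p q) :
    FreeAlgebra.lift K (genRep K hG) p = FreeAlgebra.lift K (genRep K hG) q := by
  have act_inv : ∀ (g : G) (ω : ℕ → X), hG.act g (hG.act g⁻¹ ω) = ω := fun g ω => by
    rw [← act_mul, mul_inv_cancel, act_one]
  have inv_act : ∀ (g : G) (ω : ℕ → X), hG.act g⁻¹ (hG.act g ω) = ω := fun g ω => by
    rw [← act_mul, inv_mul_cancel, act_one]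
  have ck1 : ∀ x y : X, FreeAlgebra.lift K (genRep K hG) (nekXAdj K G y * nekX K G x) =
      FreeAlgebra.lift K (genRep K hG) (if x = y then 1 else 0) := fun x y => by
    refine LinearMap.ext fun f => funext fun ω => ?_
    rw [map_mul, Module.End.mul_apply, lift_genRep_nekXAdj, lift_genRep_nekX]
    by_cases hxy : y = x
    · simp [hxy, prepend]
    · simp [hxy, Ne.symm hxy, prepend]
  have ck2 : FreeAlgebra.lift K (genRep K hG) (∑ x : X, nekX K G x * nekXAdj K G x) =
      FreeAlgebra.lift K (genRep K hG) 1 := by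
    refine LinearMap.ext fun f => funext fun ω => ?_
    simp [lift_genRep_nekX, lift_genRep_nekXAdj, prepend_tail]
  rcases h with h | ⟨p, q, h, rfl, rfl⟩
  · cases h with
    | g_adj g =>
      refine LinearMap.ext fun f => funext fun ω => ?_
      rw [lift_genRep_nekG, lift_genRep_nekGAdj, inv_inv]
    | g_mul g h =>
      refine LinearMap.ext fun f => funext fun ω => ?_
      rw [map_mul, Module.End.mul_apply, lift_genRep_nekG, lift_genRep_nekG, lift_genRep_nekG,
        mul_inv_rev, act_mul]
    | g_one =>
      refine LinearMap.ext fun f => funext fun ω => ?_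
      rw [lift_genRep_nekG, inv_one, act_one]; simp
    | ss g x =>
      refine LinearMap.ext fun f => funext fun ω => ?_
      -- Writing the point as `g η` turns the condition on its first letter into `η 0 = x`, since
      -- `g` is injective on letters.
      obtain ⟨η, rfl⟩ : ∃ η, ω = hG.act g η := ⟨_, (act_inv g ω).symm⟩
      rw [map_mul, map_mul, Module.End.mul_apply, Module.End.mul_apply, lift_genRep_nekG,
        lift_genRep_nekX, lift_genRep_nekX, lift_genRep_nekG, inv_act]
      have hinj : hG.act g η 0 = hG.letter g x ↔ η 0 = x := by
        refine ⟨fun e => ?_, fun e => by rw [← e]; rfl⟩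
        have h1 := congrArg (hG.letter g⁻¹) (show hG.letter g (η 0) = hG.letter g x from e)
        rwa [← letter_mul, ← letter_mul, inv_mul_cancel, letter_one, letter_one] at h1
      by_cases e : η 0 = x
      · rw [if_pos e, if_pos (hinj.mpr e), ← e]
        exact congrArg f (inv_act (hG.sec g (η 0)) fun n => η (n + 1)).symm
      · rw [if_neg e, if_neg (mt hinj.mp e)]
    | ck1 x y => exact ck1 x y
    | ck2 => exact ck2
  · cases h with
    | g_adj g =>
      refine LinearMap.ext fun f => funext fun ω => ?_
      rw [adj_nekG, adj_nekGAdj, lift_genRep_nekG, lift_genRep_nekGAdj]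
    | g_mul g h =>
      refine LinearMap.ext fun f => funext fun ω => ?_
      rw [adj_mul, adj_nekG, adj_nekG, adj_nekG, map_mul, Module.End.mul_apply,
        lift_genRep_nekGAdj, lift_genRep_nekGAdj, lift_genRep_nekGAdj, act_mul]
    | g_one =>
      refine LinearMap.ext fun f => funext fun ω => ?_
      rw [adj_nekG, adj_one, lift_genRep_nekGAdj, act_one]; simp
    | ss g x =>
      refine LinearMap.ext fun f => funext fun ω => ?_
      rw [adj_mul, adj_mul, adj_nekG, adj_nekX, adj_nekG, adj_nekX, map_mul, map_mul,
        Module.End.mul_apply, Module.End.mul_apply, lift_genRep_nekXAdj, lift_genRep_nekGAdj,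
        lift_genRep_nekGAdj, lift_genRep_nekXAdj, act_prepend]
    | ck1 x y =>
      rw [adj_mul, adj_nekX, adj_nekXAdj, ck1 y x, apply_ite FreeStarAlg.adj, adj_one, adj_zero]
      simp only [eq_comm]
    | ck2 =>
      rw [adj_sum, adj_one, ← ck2]
      simp only [adj_mul, adj_nekX, adj_nekXAdj]

theorem nontrivial [Fintype X] [Nontrivial K] [Nonempty X] :
    Nontrivial (NekrashevychAlgebra K hG) := by
  have : Nontrivial ((ℕ → X) → K) := Function.nontrivial
  exact (RingQuot.liftAlgHom K ⟨FreeAlgebra.lift K (genRep K hG),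
    fun _ _ h => lift_genRep_rel K hG h⟩).toRingHom.domain_nontrivial

end Representation

-- Simplicity from triviality of germs

theorem isSimpleRing (K : Type v) [Field K] {X : Type u} [Fintype X] [DecidableEq X] [Nontrivial X]
    {G : Subgroup (Equiv.Perm (List X))} {hG : IsSelfSimilar G} (H : hG.FixesStrongly) :
    IsSimpleRing (NekrashevychAlgebra K hG) := by
  have := nontrivial K hG
  refine ⟨⟨fun I => or_iff_not_imp_left.mpr fun hI => ?_⟩⟩
  obtain ⟨p, hpI, hp⟩ : ∃ p ∈ I, p ≠ 0 := by
    by_contra! h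
    exact hI (le_bot_iff.mp fun p hp => by simpa using h p hp)
  obtain ⟨n, hn⟩ := mem_expansive p 0
  obtain ⟨u, hu, h0⟩ := exists_mul_ofWord_ne_zero K hG n hp
  obtain ⟨d, q, hq, r, hr, hq0, e⟩ := exists_degreeSpan_add_tailSpan (hn u hu.ge) h0
  obtain ⟨y, hy, hyq⟩ := exists_ofWordAdj_mul_ne_zero K hG d hq0
  obtain ⟨z, v, k, h, hzv, hk, hkh⟩ := exists_ofWordAdj_mul_mul_ofWord_eq_smul_ofG H
    (ofWordAdj_mul_mem_span_ofG hy hq) hyq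
  have hr1 : ofWordAdj K hG y * r ∈ tailSpan K hG 1 := by
    simpa [ofWord] using ofWordAdj_mul_mul_ofWord_mem_tailSpan (u := []) (m := 1)
      (by simp; omega) hr
  -- As `z` and `v` have equal length, the compression that isolates `h` keeps the remainder in
  -- positive degree.
  have hr2 := ofG_mul_mem_tailSpan (ofWordAdj_mul_mul_ofWord_mem_tailSpan (y := z) (u := v) (m := 1)
    (by omega) hr1) h⁻¹
  obtain ⟨t, ht⟩ := exists_ofWordAdj_mul_mul_ofWord_eq_zero hr2 []
  rw [List.nil_append] at ht
  set a := ofWordAdj K hG t * ofG K hG h⁻¹ * ofWordAdj K hG z * ofWordAdj K hG y with ha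
  set b := ofWord K hG v * ofWord K hG t with hb
  have hmem : a * (p * ofWord K hG u) * b ∈ I :=
    I.mul_mem_right _ _ (I.mul_mem_left _ _ (I.mul_mem_right _ _ hpI))
  have hval : a * (p * ofWord K hG u) * b = algebraMap K _ k := by
    have h1 : a * q * b = algebraMap K _ k := by
      have : a * q * b = ofWordAdj K hG t * (ofG K hG h⁻¹ * (ofWordAdj K hG z *
          (ofWordAdj K hG y * q) * ofWord K hG v)) * ofWord K hG t := by
        simp only [ha, hb, mul_assoc]
      rw [this, hkh, mul_smul_comm, ← ofG_mul, inv_mul_cancel, ofG_one, mul_smul_comm, mul_one,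
        smul_mul_assoc, ofWordAdj_mul_ofWord_self, Algebra.algebraMap_eq_smul_one]
    have h2 : a * r * b = 0 := by
      rw [← ht]
      simp only [ha, hb, mul_assoc]
    rw [e, mul_add, add_mul, h1, h2, add_zero]
  rw [hval] at hmem
  have := I.mul_mem_left (algebraMap K _ k⁻¹) _ hmem
  rw [← map_mul, inv_mul_cancel₀ hk, map_one] at this
  exact (TwoSidedIdeal.one_mem_iff I).mp this

end NekrashevychAlgebra

-- Contraction of the Basilica group

namespace Basilica

theorem a_mem : a ∈ group := Subgroup.subset_closure (by simp)

theorem c_mem : c ∈ group := Subgroup.subset_closure (by simp)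

/-- The generator `a` as an element of the Basilica group. -/
def ga : group := ⟨a, a_mem⟩

/-- The generator `c` as an element of the Basilica group. -/
def gc : group := ⟨c, c_mem⟩

theorem ga_zero : isSelfSimilar.letter ga 0 = 0 ∧ isSelfSimilar.sec ga 0 = 1 :=
  isSelfSimilar.eq_of_apply_cons fun w => by simp [ga, a, aFun]

theorem ga_one : isSelfSimilar.letter ga 1 = 1 ∧ isSelfSimilar.sec ga 1 = gc :=
  isSelfSimilar.eq_of_apply_cons fun w => by simp [ga, gc, a, c, aFun]

theorem gc_zero : isSelfSimilar.letter gc 0 = 1 ∧ isSelfSimilar.sec gc 0 = 1 :=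
  isSelfSimilar.eq_of_apply_cons fun w => by simp [gc, c, cFun]

theorem gc_one : isSelfSimilar.letter gc 1 = 0 ∧ isSelfSimilar.sec gc 1 = ga :=
  isSelfSimilar.eq_of_apply_cons fun w => by simp [ga, gc, a, c, cFun]

theorem inv_of {g : group} {x y : Fin 2} {h : group}
    (H : isSelfSimilar.letter g x = y ∧ isSelfSimilar.sec g x = h) :
    isSelfSimilar.letter g⁻¹ y = x ∧ isSelfSimilar.sec g⁻¹ y = h⁻¹ := by
  obtain ⟨rfl, rfl⟩ := H
  have h1 := isSelfSimilar.letter_mul g⁻¹ g x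
  have h2 := isSelfSimilar.sec_mul g⁻¹ g x
  rw [inv_mul_cancel] at h1 h2
  rw [IsSelfSimilar.letter_one] at h1
  rw [IsSelfSimilar.sec_one] at h2
  exact ⟨h1.symm, eq_inv_of_mul_eq_one_left h2.symm⟩

/-- The generators of the Basilica group, their inverses, and the identity. -/
def gens : Set group := {1, ga, ga⁻¹, gc, gc⁻¹}

/-- The nucleus of the Basilica group. -/
def nucleus : Set group := {1, ga, ga⁻¹, gc, gc⁻¹, ga * gc⁻¹, gc * ga⁻¹}

theorem sec_mem_gens {s : group} (hs : s ∈ gens) (x : Fin 2) :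
    isSelfSimilar.sec s x ∈ gens := by
  simp only [Set.mem_insert_iff, Set.mem_singleton_iff, gens] at hs
  rcases hs with rfl | rfl | rfl | rfl | rfl <;> fin_cases x <;>
  simp [IsSelfSimilar.sec_one, ga_zero, ga_one, gc_zero, gc_one, inv_of ga_zero, inv_of ga_one,
    inv_of gc_zero, inv_of gc_one, gens]

theorem secWord_mem_gens {s : group} (hs : s ∈ gens) (u : List (Fin 2)) :
    isSelfSimilar.secWord s u ∈ gens := by
  induction u generalizing s with
  | nil => exact hs
  | cons x u ih => exact ih (sec_mem_gens hs x)

theorem sec_mem_nucleus {h : group} (hh : h ∈ nucleus) (x : Fin 2) :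
    isSelfSimilar.sec h x ∈ nucleus := by
  simp only [Set.mem_insert_iff, Set.mem_singleton_iff, nucleus] at hh
  rcases hh with rfl | rfl | rfl | rfl | rfl | rfl | rfl <;> fin_cases x <;>
  simp [IsSelfSimilar.sec_one, IsSelfSimilar.sec_mul, ga_zero, ga_one, gc_zero, gc_one,
    inv_of ga_zero, inv_of ga_one, inv_of gc_zero, inv_of gc_one, nucleus]

theorem secWord_mem_nucleus {h : group} (hh : h ∈ nucleus) (u : List (Fin 2)) :
    isSelfSimilar.secWord h u ∈ nucleus := by
  induction u generalizing h with
  | nil => exact hh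
  | cons x u ih => exact ih (sec_mem_nucleus hh x)

set_option maxHeartbeats 1600000 in
-- This is the finite check behind contraction: three levels absorb one extra generator.
theorem secWord_mul_mem_nucleus {s h : group} (hs : s ∈ gens) (hh : h ∈ nucleus)
    (x y z : Fin 2) : isSelfSimilar.secWord (s * h) [x, y, z] ∈ nucleus := by
  simp only [Set.mem_insert_iff, Set.mem_singleton_iff, nucleus, gens] at hs hh
  rcases hs with rfl | rfl | rfl | rfl | rfl <;>
  rcases hh with rfl | rfl | rfl | rfl | rfl | rfl | rfl <;>
  fin_cases x <;> fin_cases y <;> fin_cases z <;>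
  simp [IsSelfSimilar.secWord, IsSelfSimilar.sec_mul, IsSelfSimilar.letter_mul, ga_zero, ga_one,
    gc_zero, gc_one, inv_of ga_zero, inv_of ga_one, inv_of gc_zero, inv_of gc_one,
    IsSelfSimilar.sec_one, nucleus]

/-- Apart from the identity, only `a` and its inverse fix a first letter. Their sections are trivial
at `0`, and at `1` they are `c` and its inverse, which move the next letter. -/
theorem secWord_eq_one_of_mem_nucleus {h : group} (hh : h ∈ nucleus) (x y : Fin 2)
    (e : h.1 [x, y] = [x, y]) : isSelfSimilar.secWord h [x, y] = 1 := by
  rw [isSelfSimilar.apply_cons, isSelfSimilar.apply_cons, isSelfSimilar.apply_nil] at e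
  simp only [Set.mem_insert_iff, Set.mem_singleton_iff, nucleus] at hh
  revert e
  rcases hh with rfl | rfl | rfl | rfl | rfl | rfl | rfl <;>
  fin_cases x <;> fin_cases y <;>
  simp [IsSelfSimilar.secWord, IsSelfSimilar.sec_mul, IsSelfSimilar.letter_mul, ga_zero, ga_one,
    gc_zero, gc_one, inv_of ga_zero, inv_of ga_one, inv_of gc_zero, inv_of gc_one,
    IsSelfSimilar.letter_one, IsSelfSimilar.sec_one]

/-- The Basilica group is contracting. -/
theorem exists_secWord_mem_nucleus (g : group) :
    ∃ n : ℕ, ∀ u : List (Fin 2), n ≤ u.length → isSelfSimilar.secWord g u ∈ nucleus := by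
  have step : ∀ s h : group, s ∈ gens →
      (∃ n : ℕ, ∀ u : List (Fin 2), n ≤ u.length → isSelfSimilar.secWord h u ∈ nucleus) →
      ∃ n : ℕ, ∀ u : List (Fin 2), n ≤ u.length → isSelfSimilar.secWord (s * h) u ∈ nucleus := by
    rintro s h hs ⟨n, hn⟩
    refine ⟨n + 3, fun u hu => ?_⟩
    -- After `n` letters the section of `s * h` is an element of `gens` times an element of
    -- `nucleus`; three more letters bring it into `nucleus`.
    rw [← List.take_append_drop n u, IsSelfSimilar.secWord_append, IsSelfSimilar.secWord_mul]
    have hl : (u.drop n).length = u.length - n := List.length_drop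
    rcases hd : u.drop n with _ | ⟨x, _ | ⟨y, _ | ⟨z, w⟩⟩⟩
    all_goals rw [hd] at hl; simp only [List.length_cons, List.length_nil] at hl
    · omega
    · omega
    · omega
    · rw [show x :: y :: z :: w = [x, y, z] ++ w from rfl, IsSelfSimilar.secWord_append]
      exact secWord_mem_nucleus (secWord_mul_mem_nucleus (secWord_mem_gens hs _)
        (hn _ (by rw [List.length_take]; omega)) x y z) w
  obtain ⟨g, hg⟩ := g
  induction hg using Subgroup.closure_induction_left with
  | one => exact ⟨0, fun u _ => secWord_mem_nucleus (h := 1) (by simp [nucleus]) u⟩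
  | mul_left s hs h hh ih =>
    rcases hs with rfl | rfl
    · exact step ga ⟨h, hh⟩ (by simp [gens]) ih
    · exact step gc ⟨h, hh⟩ (by simp [gens]) ih
  | inv_mul_cancel s hs h hh ih =>
    rcases hs with rfl | rfl
    · exact step ga⁻¹ ⟨h, hh⟩ (by simp [gens]) ih
    · exact step gc⁻¹ ⟨h, hh⟩ (by simp [gens]) ih

theorem fixesStrongly : isSelfSimilar.FixesStrongly := by
  intro g
  obtain ⟨n, hn⟩ := exists_secWord_mem_nucleus g
  -- The first `n` letters bring the section into the nucleus; the next two make it trivial.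
  refine ⟨n + 2, fun u hu e => ?_⟩
  have ht : n ≤ (u.take n).length := by rw [List.length_take]; omega
  have hl : (u.drop n).length = u.length - n := List.length_drop
  rw [← List.take_append_drop n u] at e ⊢
  rw [isSelfSimilar.apply_append] at e
  have e2 := (List.append_inj e (isSelfSimilar.length_eq g.1 g.2 _)).2
  rw [IsSelfSimilar.secWord_append]
  have hN := hn _ ht
  generalize isSelfSimilar.secWord g (u.take n) = h at *
  rcases hd : u.drop n with _ | ⟨x, _ | ⟨y, w⟩⟩
  all_goals rw [hd] at hl; simp only [List.length_cons, List.length_nil] at hl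
  · omega
  · omega
  · rw [hd, show x :: y :: w = [x, y] ++ w from rfl, isSelfSimilar.apply_append] at e2
    have e3 := (List.append_inj e2 (isSelfSimilar.length_eq h.1 h.2 _)).1
    rw [show x :: y :: w = [x, y] ++ w from rfl, IsSelfSimilar.secWord_append,
      secWord_eq_one_of_mem_nucleus hN x y e3, IsSelfSimilar.secWord_one]

end Basilica

/-- The Basilica group has a simple Nekrashevych algebra over every field. -/
theorem mainTheorem12 (K : Type*) [Field K] :
    IsSimpleRing (NekrashevychAlgebra K Basilica.isSelfSimilar) :=
  NekrashevychAlgebra.isSimpleRing K Basilica.fixesStrongly
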